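/- Let $m\ge 2$ and let $(Y_{i,j})_{1\le i\ne j\le m}$ be random variables with finite alphabets such that, for all $i\neq j$, $$I\bigl(Y_{i,j},Y_{j,i};\{Y_{k,l}: k\ne l,\ (k,l)\neq (i,j),(j,i)\}\bigr)=0 .$$ Terminal $i\in\{1,\dots,m\}$ observes $n$ i.i.d. repetitions $X_i^n$ of $X_i=(Y_{i,j})_{j\neq i}$ and may generate private randomness $U_i$ (finite-valued, with $U_1,\dots,U_m$ mutually independent and independent of the observations). The terminals communicate interactively over a noiseless public channel: in each of finitely many time slots a designated terminal $i$ sends a symbol from a finite alphabet that is a function of $X_i^n$, $U_i$ and all earlier transmissions. Let $F$ denote all the transmissions. For $\varepsilon>0$, a function $K$ of $(X_1^n,\dots,X_m^n,U_1,\dots,U_m)$ with values in a finite set $\mathcal K$ is an $\varepsilon$-secret key for all terminals if each terminal $i$ can compute from $(X_i^n,U_i,F)$ an estimate $K_i$ with $\Pr[K_i=K]\ge 1-\varepsilon$, and $\frac1n I(K;F)\le\varepsilon$, and $\frac1n H(K)\ge\frac1n\log|\mathcal K|-\varepsilon$. A rate $R$ is achievable if for every $\varepsilon>0$ and all sufficiently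 large $n$ there is an $\varepsilon$-secret key with $\frac1n H(K)\ge R-\varepsilon$; the group secret key capacity $C_{SK}(\{1,\dots,m\})$ is the supremum of the achievable rates. Let $G_3$ be the weighted undirected complete graph on $\{1,\dots,m\}$ in which the edge $\{i,j\}$ has weight $I(Y_{i,j};Y_{j,i})$. A multi-cut of $G_3$ is a partition of the nodes into $L$ nonempty sets, $2\le L\le m$; its weight is the sum of the weights of the edges whose end-nodes lie in different sets, and its normalized weight is its weight divided by $L-1$. A cut is a multi-cut with $L=2$. Then $C_{SK}(\{1,\dots,m\})$ is at most the minimal normalized weight of the multi-cuts of $G_3$. Moreover, this minimal normalized weight, and hence also $C_{SK}(\{1,\dots,m\})$, is at most each of (i) the minimal weight of the cuts of $G_3$; (ii) the sum of the weights of all edges of $G_3$ divided by $m-1$. -/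

import Mathlib

open MeasureTheory Filter

noncomputable section

namespace GroupKey

/-! ### Entropy and mutual information of finite-valued random variables

Logarithms are natural; all quantities below use the same base. -/

section Information

variable {Ω S T : Type*} [MeasurableSpace Ω] [Fintype S] [Fintype T]

/-- Shannon entropy `H(Z) = -∑ P(Z = z) log P(Z = z)`. -/
def entropy (μ : Measure Ω) (Z : Ω → S) : ℝ :=
  ∑ z : S, Real.negMulLog (μ.real (Z ⁻¹' {z}))

/-- Mutual information `I(Z; W) = H(Z) + H(W) - H(Z, W)`. -/
def mutualInfo (μ : Measure Ω) (Z : Ω → S) (W : Ω → T) : ℝ :=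
  entropy μ Z + entropy μ W - entropy μ (fun ω => (Z ω, W ω))

end Information

/-! ### Secret key agreement by public discussion -/

/-- A public discussion and key agreement scheme of block length `n` for `m` terminals with finite
source alphabets `𝒳 i`.

Terminal `i` holds `X_i^n` and a private random variable `U_i` with values in `Fin (q i)`; the `U_i`
are independent of each other and of the source. In time slot `t` (`t = 0, …, slots - 1`) the
terminal `speaker t` sends over the public noiseless channel a symbol of `Fin L` that may depend on
its own observation and randomness and on all earlier transmissions; the values of `speaker` and
`send` at `t ≥ slots` are irrelevant. At the end terminal `i` computes its estimate `estimate i` of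
the key from what it knows. The key itself is a function of all the observations and randomness,
with values in `Fin keySize`. -/
structure Scheme (m : ℕ) (𝒳 : Fin m → Type*) (n : ℕ) where
  q : Fin m → ℕ
  randLaw : ∀ i, PMF (Fin (q i))
  slots : ℕ
  L : ℕ
  speaker : ℕ → Fin m
  send : ∀ t : ℕ, (Fin n → 𝒳 (speaker t)) → Fin (q (speaker t)) → (Fin t → Fin L) → Fin L
  keySize : ℕ
  key : (∀ i, Fin n → 𝒳 i) → (∀ i, Fin (q i)) → Fin keySize
  estimate : ∀ i, (Fin n → 𝒳 i) → Fin (q i) → (Fin slots → Fin L) → Fin keySize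

namespace Scheme

variable {m : ℕ} {𝒳 : Fin m → Type*} {n : ℕ} (c : Scheme m 𝒳 n)

/-- The first `t` public transmissions. -/
def transcript (x : ∀ i, Fin n → 𝒳 i) (u : ∀ i, Fin (c.q i)) : (t : ℕ) → (Fin t → Fin c.L)
  | 0 => Fin.elim0
  | t + 1 =>
    Fin.snoc (α := fun _ => Fin c.L) (transcript x u t)
      (c.send t (x (c.speaker t)) (u (c.speaker t)) (transcript x u t))

variable {Ω : Type*} [MeasurableSpace Ω]

/-- The sample space: `n` independent copies of the source, and the private randomness. -/
abbrev Sample (Ω : Type*) : Type _ := (Fin n → Ω) × (∀ i, Fin (c.q i))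

/-- The law of `n` independent copies of the source and the independent private randomness. -/
def law (μ : Measure Ω) : Measure (c.Sample Ω) :=
  (Measure.pi fun _ : Fin n => μ).prod (Measure.pi fun i => (c.randLaw i).toMeasure)

variable (X : ∀ i, Ω → 𝒳 i)

/-- The observation `X_i^n` of terminal `i`. -/
def obs (ω : c.Sample Ω) (i : Fin m) : Fin n → 𝒳 i := fun s => X i (ω.1 s)

/-- The key `K` as a random variable. -/
def keyRV (ω : c.Sample Ω) : Fin c.keySize := c.key (c.obs X ω) ω.2

/-- All the public transmissions `F` as a random variable. -/
def publicRV (ω : c.Sample Ω) : Fin c.slots → Fin c.L := c.transcript (c.obs X ω) ω.2 c.slots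

/-- The estimate `K_i` of the key at terminal `i` as a random variable. -/
def estimateRV (i : Fin m) (ω : c.Sample Ω) : Fin c.keySize :=
  c.estimate i (c.obs X ω i) (ω.2 i) (c.publicRV X ω)

/-- The scheme generates an `ε`-secret key for the set `A` of terminals: every terminal of `A`
recovers `K` with probability at least `1 - ε`, the key is nearly independent of the public
transmissions, and it is nearly uniform. -/
structure IsSecretKey (μ : Measure Ω) (A : Finset (Fin m)) (ε : ℝ) : Prop where
  recoverable : ∀ i ∈ A, 1 - ε ≤ (c.law μ).real {ω | c.estimateRV X i ω = c.keyRV X ω}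
  secret : mutualInfo (c.law μ) (c.keyRV X) (c.publicRV X) / n ≤ ε
  uniform : Real.log c.keySize / n - ε ≤ entropy (c.law μ) (c.keyRV X) / n

end Scheme

section Capacity

variable {m : ℕ} {𝒳 : Fin m → Type*} {Ω : Type*} [MeasurableSpace Ω]

/-- `R` is an achievable secret key rate for `A`: for every `ε > 0` and all large `n` there is an
`ε`-secret key of entropy rate `H(K) / n ≥ R - ε`. -/
def IsAchievableRate (μ : Measure Ω) (X : ∀ i, Ω → 𝒳 i) (A : Finset (Fin m)) (R : ℝ) : Prop :=
  ∀ ε : ℝ, 0 < ε → ∀ᶠ n : ℕ in atTop, ∃ c : Scheme m 𝒳 n,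
    c.IsSecretKey X μ A ε ∧ R - ε ≤ entropy (c.law μ) (c.keyRV X) / n

/-- The secret key capacity `C_SK(A)`, the supremum of the achievable rates. It is taken in the
extended reals, so that an upper bound on it is an upper bound on every achievable rate. -/
def secretKeyCapacity (μ : Measure Ω) (X : ∀ i, Ω → 𝒳 i) (A : Finset (Fin m)) : EReal :=
  ⨆ (R : ℝ) (_ : IsAchievableRate μ X A R), (R : EReal)

end Capacity

/-! ### The pair-wise independent network -/

section Network

variable {m : ℕ} {α : Fin m → Fin m → Type*} {Ω : Type*} [MeasurableSpace Ω]

/-- The observation `X_i = (Y_{i,j})_{j ≠ i}` of terminal `i`. -/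
def observation (Y : ∀ i j, Ω → α i j) (i : Fin m) (ω : Ω) : ∀ j : {j : Fin m // j ≠ i}, α i j :=
  fun j => Y i j ω

/-- `I(Y_{i,j}, Y_{j,i}; {Y_{k,l} : k ≠ l, (k,l) ≠ (i,j), (j,i)}) = 0` for all `i ≠ j`. -/
def PairwiseIndependent [∀ i j, Fintype (α i j)] (μ : Measure Ω) (Y : ∀ i j, Ω → α i j) : Prop :=
  ∀ i j : Fin m, i ≠ j →
    mutualInfo μ (fun ω => (Y i j ω, Y j i ω))
      (fun ω (p : {p : Fin m × Fin m // p.1 ≠ p.2 ∧ p ≠ (i, j) ∧ p ≠ (j, i)}) =>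
        Y p.1.1 p.1.2 ω) = 0

/-- The edge weights `I(Y_{i,j}; Y_{j,i})` of the undirected graph on the terminals. They are
symmetric in `i` and `j`. -/
def edgeWeight [∀ i j, Fintype (α i j)] (μ : Measure Ω) (Y : ∀ i j, Ω → α i j)
    (i j : Fin m) : ℝ :=
  mutualInfo μ (Y i j) (Y j i)

end Network

/-! ### Multi-cuts of a weighted undirected graph

The graph is the complete graph on `Fin m`; the edge `{i, j}` is listed once, with `i < j`, and has
weight `w i j`. A multi-cut is a partition of the nodes into at least two (nonempty) sets. -/

section Cuts

variable {m : ℕ}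

/-- The sum of the weights of the edges whose end-nodes lie in different sets of `P`. -/
def multiCutWeight (w : Fin m → Fin m → ℝ) (P : Finpartition (Finset.univ : Finset (Fin m))) : ℝ :=
  ∑ e : Fin m × Fin m with e.1 < e.2 ∧ P.part e.1 ≠ P.part e.2, w e.1 e.2

/-- The weight of a multi-cut into `L` sets divided by `L - 1`. -/
def normalizedWeight (w : Fin m → Fin m → ℝ)
    (P : Finpartition (Finset.univ : Finset (Fin m))) : ℝ :=
  multiCutWeight w P / ((P.parts.card : ℝ) - 1)

/-- The minimal normalized weight of the multi-cuts (there are finitely many). -/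
def minNormalizedWeight (w : Fin m → Fin m → ℝ) : EReal :=
  ⨅ (P : Finpartition (Finset.univ : Finset (Fin m))) (_ : 2 ≤ P.parts.card),
    (normalizedWeight w P : EReal)

/-- The minimal weight of the cuts, i.e. of the multi-cuts into exactly two sets. -/
def minCutWeight (w : Fin m → Fin m → ℝ) : EReal :=
  ⨅ (P : Finpartition (Finset.univ : Finset (Fin m))) (_ : P.parts.card = 2),
    (multiCutWeight w P : EReal)

/-- The sum of the weights of all edges. -/
def totalWeight (w : Fin m → Fin m → ℝ) : ℝ :=
  ∑ e : Fin m × Fin m with e.1 < e.2, w e.1 e.2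

end Cuts

end GroupKey

end

open MeasureTheory Filter

noncomputable section

namespace GroupKey

/-! Fix a partition of the terminals into `L` blocks and let each block `B` act as one terminal with
initial knowledge `Z_B`. The governing quantity is `Δ = ∑ H(Z_B) - H(Z)`, where `Z` is all the data.
Given `(K, F)`, subadditivity yields `H(Z) ≤ ∑ H(Z_B, K, F) - (L - 1) H(K, F)`. Fano's inequality
replaces `H(Z_B, K, F)` by `H(Z_B, F)` up to a small error. Each transmission is a function of one
block and the past, so `∑ H(Z_B, F) ≤ ∑ H(Z_B) + (L - 1) H(F)`. Together these bound `(L - 1) H(K |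
F)` by `Δ` plus the Fano error (`card_sub_one_mul_entropy_key_le`).

Private randomness cancels in `Δ` and the rest is `n` times its single-letter value
(`entropy_blockData`); letting `ε` tend to `0` gives `IsAchievableRate.mul_le`.

In a pair-wise independent network `Δ` is bounded edge by edge: the pairs `(Y_{i,j}, Y_{j,i})` are
mutually independent, and an edge contributes `I(Y_{i,j}; Y_{j,i})` if it is cut and `0` otherwise
(`sum_entropy_observation_sub_le`). The bounds (i) and (ii) come from two-block partitions and from
the partition into singletons. -/

/-! ### Entropy calculus on a finite probability space -/

section Toolkit

variable {T : Type*} [MeasurableSpace T] (ν : Measure T) [IsProbabilityMeasure ν]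

/-- The probability of the level set of `f` through `t`. -/
def levelProb {S : Type*} (f : T → S) (t : T) : ℝ := ν.real (f ⁻¹' {f t})

lemma measureReal_singleton_le_levelProb {S : Type*} (f : T → S) (t : T) :
    ν.real {t} ≤ levelProb ν f t :=
  measureReal_mono (by intro x hx; simp_all)

/-- If `g` determines `f`, then the level sets of `f` are larger. -/
lemma levelProb_le_of_determines {S S' : Type*} (f : T → S) (g : T → S')
    (h : ∀ x y, g x = g y → f x = f y) (t : T) : levelProb ν g t ≤ levelProb ν f t :=
  measureReal_mono fun x hx => h x t hx

lemma entropy_nonneg {S : Type*} [Fintype S] (f : T → S) : 0 ≤ entropy ν f :=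
  Finset.sum_nonneg fun _ _ => Real.negMulLog_nonneg measureReal_nonneg measureReal_le_one

variable [Fintype T] [DiscreteMeasurableSpace T]

open Classical in
lemma measureReal_eq_sum_singleton (s : Set T) :
    ν.real s = ∑ t : T, if t ∈ s then ν.real {t} else 0 := by
  rw [← Finset.sum_filter, sum_measureReal_singleton]
  simp

lemma sum_measureReal_singleton_univ : ∑ t : T, ν.real {t} = 1 := by
  rw [sum_measureReal_singleton]
  simp

/-- Summing over sample points instead of values allows variables with different alphabets to be
compared pointwise. -/
lemma entropy_eq_sum {S : Type*} [Fintype S] (f : T → S) :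
    entropy ν f = ∑ t : T, ν.real {t} * -Real.log (levelProb ν f t) := by
  classical
  unfold entropy
  have : ∀ z : S, Real.negMulLog (ν.real (f ⁻¹' {z})) =
      ∑ t : T, if f t = z then ν.real {t} * -Real.log (levelProb ν f t) else 0 := by
    intro z
    rw [Real.negMulLog]
    conv_lhs => rw [neg_mul, ← mul_neg]; lhs; rw [measureReal_eq_sum_singleton]
    rw [Finset.sum_mul]
    refine Finset.sum_congr rfl fun t _ => ?_
    by_cases h : f t = z
    · subst h
      simp [levelProb]
    · simp [h]
  simp_rw [this]
  rw [Finset.sum_comm]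
  simp

/-- If `g` determines `f`, then `H(f) ≤ H(g)`. -/
lemma entropy_le_of_determines {S S' : Type*} [Fintype S] [Fintype S'] (f : T → S) (g : T → S')
    (h : ∀ x y, g x = g y → f x = f y) : entropy ν f ≤ entropy ν g := by
  rw [entropy_eq_sum, entropy_eq_sum]
  refine Finset.sum_le_sum fun t _ => ?_
  rcases (measureReal_nonneg (μ := ν) (s := {t})).eq_or_lt with h0 | h0
  · simp [← h0]
  · have := measureReal_singleton_le_levelProb ν g t
    have h2 := levelProb_le_of_determines ν f g h t
    gcongr
    linarith

lemma entropy_eq_of_determines {S S' : Type*} [Fintype S] [Fintype S'] (f : T → S) (g : T → S')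
    (h : ∀ x y, g x = g y ↔ f x = f y) : entropy ν f = entropy ν g :=
  le_antisymm (entropy_le_of_determines ν f g fun x y => (h x y).1)
    (entropy_le_of_determines ν g f fun x y => (h x y).2)

lemma entropy_eq_zero_of_const {S : Type*} [Fintype S] (f : T → S) (h : ∀ x y, f x = f y) :
    entropy ν f = 0 := by
  rw [entropy_eq_sum]
  refine Finset.sum_eq_zero fun t _ => ?_
  have : f ⁻¹' {f t} = Set.univ := by ext x; simp [h x t]
  simp [levelProb, this]

-- This is the mean of the ratio whose logarithm appears in submodularity. Expand the masses of the
-- `A`- and `B`-classes over points `a`, `b`. The `t` compatible with both lie in a single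
-- `J`-class, so summing over them costs a factor at most `1`. What remains is a sum over pairs with
-- `M a = M b`, which the division by the mass of the `M`-class normalizes.
open Classical in
lemma sum_levelProb_ratio_le_one {SA SB SJ SM : Type*} (A : T → SA) (B : T → SB) (J : T → SJ)
    (M : T → SM) (hMA : ∀ x y, A x = A y → M x = M y) (hMB : ∀ x y, B x = B y → M x = M y)
    (hJ : ∀ x y, A x = A y → B x = B y → J x = J y) :
    ∑ t, ν.real {t} * (levelProb ν A t * levelProb ν B t /
      (levelProb ν J t * levelProb ν M t)) ≤ 1 := by
  have nn : ∀ t, 0 ≤ ν.real {t} := fun t => measureReal_nonneg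
  have nl : ∀ t, 0 ≤ levelProb ν M t := fun t => measureReal_nonneg
  have expand : ∀ t, ν.real {t} * (levelProb ν A t * levelProb ν B t /
      (levelProb ν J t * levelProb ν M t)) = ∑ a, ∑ b, if A t = A a ∧ B t = B b then
        ν.real {a} * ν.real {b} * (ν.real {t} / levelProb ν J t) / levelProb ν M t else 0 := by
    intro t
    have hA : levelProb ν A t = ∑ a, if A t = A a then ν.real {a} else 0 := by
      rw [levelProb, measureReal_eq_sum_singleton]
      simp [eq_comm]
    have hB : levelProb ν B t = ∑ b, if B t = B b then ν.real {b} else 0 := by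
      rw [levelProb, measureReal_eq_sum_singleton]
      simp [eq_comm]
    rw [hA, hB, Finset.sum_mul_sum, Finset.sum_div, Finset.mul_sum]
    refine Finset.sum_congr rfl fun a _ => ?_
    rw [Finset.sum_div, Finset.mul_sum]
    refine Finset.sum_congr rfl fun b _ => ?_
    by_cases h1 : A t = A a <;> by_cases h2 : B t = B b <;> simp [h1, h2]
    ring
  calc _ = ∑ a, ∑ b, ∑ t, if A t = A a ∧ B t = B b then
        ν.real {a} * ν.real {b} * (ν.real {t} / levelProb ν J t) / levelProb ν M t else 0 := by
        simp_rw [expand]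
        rw [Finset.sum_comm]
        refine Finset.sum_congr rfl fun a _ => ?_
        rw [Finset.sum_comm]
    _ ≤ ∑ a, ∑ b, if M b = M a then ν.real {a} * ν.real {b} / levelProb ν M a else 0 := by
        refine Finset.sum_le_sum fun a _ => Finset.sum_le_sum fun b _ => ?_
        by_cases hab : ∃ t, A t = A a ∧ B t = B b
        · obtain ⟨t₀, h1, h2⟩ := hab
          have hMa : M t₀ = M a := hMA _ _ h1
          have hMb : M t₀ = M b := hMB _ _ h2
          rw [if_pos (hMb.symm.trans hMa)]
          have hclass : ∑ t, (if A t = A a ∧ B t = B b then ν.real {t} else 0) ≤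
              levelProb ν J t₀ := by
            rw [levelProb, measureReal_eq_sum_singleton]
            refine Finset.sum_le_sum fun t _ => ?_
            by_cases h : A t = A a ∧ B t = B b
            · rw [if_pos h, if_pos]
              exact hJ _ _ (h.1.trans h1.symm) (h.2.trans h2.symm)
            · rw [if_neg h]
              split_ifs <;> simp [nn]
          calc _ = ∑ t, ν.real {a} * ν.real {b} / levelProb ν M a *
                ((if A t = A a ∧ B t = B b then ν.real {t} else 0) / levelProb ν J t₀) := by
                refine Finset.sum_congr rfl fun t _ => ?_
                by_cases h : A t = A a ∧ B t = B b
                · rw [if_pos h, if_pos h]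
                  have e1 : levelProb ν M t = levelProb ν M a := by
                    rw [levelProb, levelProb, hMA _ _ h.1]
                  have e2 : levelProb ν J t = levelProb ν J t₀ := by
                    rw [levelProb, levelProb, hJ t t₀ (h.1.trans h1.symm) (h.2.trans h2.symm)]
                  rw [e1, e2]
                  ring
                · simp [h]
            _ ≤ _ := by
                rw [← Finset.mul_sum, ← Finset.sum_div]
                exact mul_le_of_le_one_right
                  (div_nonneg (mul_nonneg (nn _) (nn _)) (nl _))
                  (div_le_one_of_le₀ hclass measureReal_nonneg)
        · have hab' : ∀ t, ¬ (A t = A a ∧ B t = B b) := fun t h => hab ⟨t, h⟩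
          simp only [hab', if_false, Finset.sum_const_zero]
          split_ifs
          · exact div_nonneg (mul_nonneg (nn _) (nn _)) (nl _)
          · exact le_rfl
    _ = ∑ a, ν.real {a} * (levelProb ν M a / levelProb ν M a) := by
        refine Finset.sum_congr rfl fun a _ => ?_
        have hM : levelProb ν M a = ∑ b, if M b = M a then ν.real {b} else 0 := by
          rw [levelProb, measureReal_eq_sum_singleton]
          simp
        conv_rhs => rhs; lhs; rw [hM]
        rw [Finset.sum_div, Finset.mul_sum]
        refine Finset.sum_congr rfl fun b _ => ?_
        split_ifs
        · ring
        · simp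
    _ ≤ ∑ a, ν.real {a} :=
        Finset.sum_le_sum fun a _ => mul_le_of_le_one_right (nn a) (div_self_le_one _)
    _ = 1 := sum_measureReal_singleton_univ ν

/-- Submodularity of entropy: if `M` is determined by `A` and by `B`, and `J` by `A` and `B`
together, then `H(J) + H(M) ≤ H(A) + H(B)`. -/
lemma entropy_submodular {SA SB SJ SM : Type*} [Fintype SA] [Fintype SB] [Fintype SJ] [Fintype SM]
    (A : T → SA) (B : T → SB) (J : T → SJ)
    (M : T → SM) (hMA : ∀ x y, A x = A y → M x = M y) (hMB : ∀ x y, B x = B y → M x = M y)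
    (hJ : ∀ x y, A x = A y → B x = B y → J x = J y) :
    entropy ν J + entropy ν M ≤ entropy ν A + entropy ν B := by
  -- The inequality `log r ≤ r - 1`, weighted by the mass of `t`; null points are treated apart
  -- because `r` may degenerate there.
  have key : ∀ t, ν.real {t} * -Real.log (levelProb ν J t) +
      ν.real {t} * -Real.log (levelProb ν M t) - ν.real {t} * -Real.log (levelProb ν A t) -
      ν.real {t} * -Real.log (levelProb ν B t) ≤ ν.real {t} * (levelProb ν A t * levelProb ν B t /
      (levelProb ν J t * levelProb ν M t)) - ν.real {t} := by
    intro t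
    rcases (measureReal_nonneg (μ := ν) (s := {t})).eq_or_lt with h0 | h0
    · simp [← h0]
    · have hA := h0.trans_le (measureReal_singleton_le_levelProb ν A t)
      have hB := h0.trans_le (measureReal_singleton_le_levelProb ν B t)
      have hJ := h0.trans_le (measureReal_singleton_le_levelProb ν J t)
      have hM := h0.trans_le (measureReal_singleton_le_levelProb ν M t)
      have h := Real.log_le_sub_one_of_pos (div_pos (mul_pos hA hB) (mul_pos hJ hM))
      rw [Real.log_div (mul_pos hA hB).ne' (mul_pos hJ hM).ne', Real.log_mul hA.ne' hB.ne',
        Real.log_mul hJ.ne' hM.ne'] at h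
      nlinarith [mul_le_mul_of_nonneg_left h h0.le]
  have h := Finset.sum_le_sum fun t (_ : t ∈ Finset.univ) => key t
  simp only [Finset.sum_sub_distrib, Finset.sum_add_distrib, ← entropy_eq_sum,
    sum_measureReal_singleton_univ] at h
  have := sum_levelProb_ratio_le_one ν A B J M hMA hMB hJ
  linarith

/-- Fano's inequality: if `K` can be recovered from `W` with error probability `ν E`, then
`H(K, W) ≤ H(W) + 1 + ν E · log |𝒦|`. -/
lemma entropy_prod_le_of_estimate {N : ℕ} {S : Type*} [Fintype S] (K : T → Fin N) (W : T → S)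
    (g : S → Fin N) :
    entropy ν (fun t => (K t, W t)) ≤
      entropy ν W + (1 + ν.real {t | g (W t) ≠ K t} * Real.log N) := by
  classical
  set p := ν.real {t | g (W t) ≠ K t}
  -- `K'` is the correction to the estimate: together with `W` it determines `K`, and it differs
  -- from `none` only with probability `p`.
  let K' : T → Option (Fin N) := fun t => if g (W t) = K t then none else some (K t)
  have h1 : entropy ν (fun t => (K t, W t)) + entropy ν (fun _ : T => ()) ≤
      entropy ν K' + entropy ν W := by
    refine entropy_submodular ν _ _ _ _ (fun _ _ _ => rfl) (fun _ _ _ => rfl) ?_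
    intro x y hK hW
    simp only [K', hW] at hK
    refine Prod.ext ?_ hW
    show K x = K y
    split_ifs at hK with a b b
    · exact a.symm.trans b
    · simpa using hK
  have h2 := entropy_nonneg ν (fun _ : T => ())
  suffices h3 : entropy ν K' ≤ 1 + p * Real.log N by linarith
  -- A tangent-line bound, used with `M = 1` for `none` and `M = N` for the other values. The
  -- corrections add up to `p + (1 - p)`, which is the constant `1` in Fano's inequality.
  have bound : ∀ x : ℝ, 0 ≤ x → ∀ M : ℝ, 0 < M →
      Real.negMulLog x ≤ x * Real.log M + (1 / M - x) := by
    intro x hx M hM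
    rcases hx.eq_or_lt with rfl | hx
    · simp [hM.le]
    · have h := Real.log_le_sub_one_of_pos (show 0 < 1 / (M * x) by positivity)
      rw [Real.log_div one_ne_zero (by positivity), Real.log_one,
        Real.log_mul hM.ne' hx.ne'] at h
      have h' := mul_le_mul_of_nonneg_left h hx.le
      have : x * (1 / (M * x) - 1) = 1 / M - x := by field_simp
      rw [Real.negMulLog]
      linarith
  have hnone : ν.real (K' ⁻¹' {none}) = 1 - p := by
    have : K' ⁻¹' {none} = {t | g (W t) ≠ K t}ᶜ := by
      ext t
      by_cases h : g (W t) = K t <;> simp [K', h]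
    rw [this, probReal_compl_eq_one_sub (Set.toFinite _).measurableSet]
  have hsome : ∑ k, ν.real (K' ⁻¹' {some k}) = p := by
    have h := sum_measureReal_preimage_singleton (μ := ν) (f := K') Finset.univ
      (fun y _ => (Set.toFinite _).measurableSet)
    rw [Fintype.sum_option, hnone] at h
    simp at h
    linarith
  unfold entropy
  rw [Fintype.sum_option, hnone]
  have b0 := bound (1 - p) (hnone ▸ measureReal_nonneg) 1 one_pos
  simp at b0
  rcases Nat.eq_zero_or_pos N with rfl | hN
  · simp at hsome ⊢
    linarith
  have hN' : (0 : ℝ) < N := by exact_mod_cast hN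
  have b1 : ∑ k, Real.negMulLog (ν.real (K' ⁻¹' {some k})) ≤
      ∑ k, (ν.real (K' ⁻¹' {some k}) * Real.log N + (1 / N - ν.real (K' ⁻¹' {some k}))) :=
    Finset.sum_le_sum fun k _ => bound _ measureReal_nonneg _ hN'
  rw [Finset.sum_add_distrib, Finset.sum_sub_distrib, ← Finset.sum_mul, hsome] at b1
  have : ∑ _k : Fin N, (1 : ℝ) / N = 1 := by simp; field_simp
  linarith

end Toolkit

/-! ### Entropy under maps and products -/

section Products

lemma entropy_map {Ω T S : Type*} [MeasurableSpace Ω] [MeasurableSpace T] [Finite T]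
    [DiscreteMeasurableSpace T] [Fintype S] (μ : Measure Ω) {Z : Ω → T} (hZ : Measurable Z)
    (f : T → S) : entropy (μ.map Z) f = entropy μ (fun ω => f (Z ω)) := by
  refine Finset.sum_congr rfl fun s _ => ?_
  rw [map_measureReal_apply hZ (Set.toFinite _).measurableSet]
  rfl

lemma entropy_comp_injective {Ω S S' : Type*} [MeasurableSpace Ω] [Fintype S] [Fintype S']
    (μ : Measure Ω) (f : Ω → S) (e : S → S') (he : e.Injective) :
    entropy μ (fun ω => e (f ω)) = entropy μ f := by
  classical
  symm
  refine Finset.sum_of_injOn e he.injOn (by simp) ?_ ?_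
  · intro s _ hs
    have : (fun ω => e (f ω)) ⁻¹' {s} = ∅ := by
      ext ω
      simp only [Set.mem_preimage, Set.mem_singleton_iff, Set.mem_empty_iff_false, iff_false]
      rintro rfl
      exact hs ⟨f ω, by simp, rfl⟩
    simp [this]
  · intro s _
    congr 2
    ext ω
    simp [he.eq_iff]

lemma entropy_measurePreserving {Ω Ω' S : Type*} [MeasurableSpace Ω] [MeasurableSpace Ω']
    [Fintype S] [MeasurableSpace S] [MeasurableSingletonClass S] {μ : Measure Ω} {μ' : Measure Ω'}
    {g : Ω → Ω'} (hg : MeasurePreserving g μ μ') {f : Ω' → S} (hf : Measurable f) :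
    entropy μ (fun ω => f (g ω)) = entropy μ' f := by
  refine Finset.sum_congr rfl fun s _ => ?_
  rw [← hg.measureReal_preimage (hf (measurableSet_singleton s)).nullMeasurableSet]
  rfl

lemma entropy_prodMk_of_indepFun {Ω S S' : Type*} [MeasurableSpace Ω] [Fintype S] [Fintype S']
    [MeasurableSpace S] [MeasurableSingletonClass S] [MeasurableSpace S']
    [MeasurableSingletonClass S'] (μ : Measure Ω) [IsProbabilityMeasure μ] {f : Ω → S} {g : Ω → S'}
    (hf : Measurable f) (hg : Measurable g) (h : ProbabilityTheory.IndepFun f g μ) :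
    entropy μ (fun ω => (f ω, g ω)) = entropy μ f + entropy μ g := by
  have hprod : ∀ s s', μ.real ((fun ω => (f ω, g ω)) ⁻¹' {(s, s')}) =
      μ.real (f ⁻¹' {s}) * μ.real (g ⁻¹' {s'}) := by
    intro s s'
    have h1 := (ProbabilityTheory.indepFun_iff_measure_inter_preimage_eq_mul.1 h) {s} {s'}
      (measurableSet_singleton s) (measurableSet_singleton s')
    rw [measureReal_def, measureReal_def, measureReal_def, ← ENNReal.toReal_mul, ← h1]
    congr 2
    ext ω
    simp
  have hsf : ∑ s, μ.real (f ⁻¹' {s}) = 1 := by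
    rw [sum_measureReal_preimage_singleton _ fun y _ => hf (measurableSet_singleton y)]
    simp
  have hsg : ∑ s, μ.real (g ⁻¹' {s}) = 1 := by
    rw [sum_measureReal_preimage_singleton _ fun y _ => hg (measurableSet_singleton y)]
    simp
  unfold entropy
  rw [Fintype.sum_prod_type]
  simp_rw [hprod, Real.negMulLog_mul, Finset.sum_add_distrib, ← Finset.sum_mul, ← Finset.mul_sum]
  rw [hsg, ← Finset.sum_mul, hsf]
  simp

/-- The subfamily `s` permits induction, and serves later as the set of terminals of a block. -/
lemma entropy_pi_of_iIndepFun {Ω ι : Type*} [MeasurableSpace Ω] [Fintype ι] [DecidableEq ι]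
    {S : ι → Type*}
    [∀ i, Fintype (S i)] [∀ i, MeasurableSpace (S i)] [∀ i, MeasurableSingletonClass (S i)]
    (μ : Measure Ω) [IsProbabilityMeasure μ] {f : ∀ i, Ω → S i} (hf : ∀ i, Measurable (f i))
    (h : ProbabilityTheory.iIndepFun f μ) (s : Finset ι) :
    entropy μ (fun ω (i : s) => f i ω) = ∑ i ∈ s, entropy μ (f i) := by
  induction s using Finset.induction_on with
  | empty =>
    have : ∀ z : (∀ i : (∅ : Finset ι), S i),
        (fun ω (i : (∅ : Finset ι)) => f i ω) ⁻¹' {z} = Set.univ := by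
      intro z
      ext ω
      simp only [Set.mem_preimage, Set.mem_singleton_iff, Set.mem_univ, iff_true]
      funext i
      exact absurd i.2 (Finset.notMem_empty _)
    simp [entropy, this]
  | insert a s ha ih =>
    rw [Finset.sum_insert ha, ← ih]
    have hind : ProbabilityTheory.IndepFun (f a) (fun ω (i : s) => f i ω) μ := by
      have h1 := h.indepFun_finset {a} s (by simpa using ha) hf
      have h2 : Measurable fun z : (∀ i : ({a} : Finset ι), S i) =>
          (z ⟨a, Finset.mem_singleton_self a⟩ : S a) :=
        measurable_pi_apply (X := fun i : ({a} : Finset ι) => S i) _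
      exact h1.comp h2 measurable_id
    rw [← entropy_prodMk_of_indepFun μ (hf a)
      (measurable_pi_lambda (fun ω (i : s) => f i ω) fun i => hf i) hind]
    let e : (∀ i : (insert a s : Finset ι), S i) → S a × ∀ i : s, S i :=
      fun z => (z ⟨a, by simp⟩, fun i => z ⟨i, by simp⟩)
    have he : e.Injective := by
      intro z z' hz
      funext ⟨i, hi⟩
      rcases Finset.mem_insert.1 hi with rfl | hi'
      · exact congrArg Prod.fst hz
      · exact congrFun (congrArg Prod.snd hz) ⟨i, hi'⟩
    rw [← entropy_comp_injective μ _ e he]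

end Products

/-! ### Public discussion on a finite probability space -/

section Discussion

variable {T : Type*} [Fintype T] [MeasurableSpace T] [DiscreteMeasurableSpace T]
  (ν : Measure T) [IsProbabilityMeasure ν] {ι : Type*} [DecidableEq ι] {S : ι → Type*}
  [∀ b, Fintype (S b)] (Z : ∀ b, T → S b)

/-- Subadditivity of conditional entropy, for a finite family of variables. -/
lemma entropy_family_le_sum {C : Type*} [Fintype C] (c : T → C) (s : Finset ι) :
    entropy ν (fun t => (fun b : s => Z b t, c t)) + s.card * entropy ν c ≤
      ∑ b ∈ s, entropy ν (fun t => (Z b t, c t)) + entropy ν c := by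
  induction s using Finset.induction_on with
  | empty =>
    have := entropy_le_of_determines ν (fun t => (fun b : (∅ : Finset ι) => Z b t, c t)) c
      (fun x y h => Prod.ext (funext fun b => absurd b.2 (Finset.notMem_empty _)) h)
    simpa using this
  | insert a s ha ih =>
    rw [Finset.sum_insert ha, Finset.card_insert_of_notMem ha]
    -- The conditioning variable `c` is the common part.
    have := entropy_submodular ν (fun t => (Z a t, c t)) (fun t => (fun b : s => Z b t, c t))
      (fun t => (fun b : (insert a s : Finset ι) => Z b t, c t)) c
      (fun x y h => (Prod.ext_iff.1 h).2) (fun x y h => (Prod.ext_iff.1 h).2) ?_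
    · push_cast
      linarith
    · intro x y h1 h2
      refine Prod.ext (funext fun ⟨b, hb⟩ => ?_) (Prod.ext_iff.1 h1).2
      rcases Finset.mem_insert.1 hb with rfl | hb'
      · exact (Prod.ext_iff.1 h1).1
      · exact congrFun (Prod.ext_iff.1 h2).1 ⟨b, hb'⟩

/-- Public discussion does not increase the multivariate mutual information of the
variables `Z b`. -/
lemma sum_entropy_discussion_le {A : Type*} [Fintype A] {s : Finset ι}
    (F : ∀ k : ℕ, T → (Fin k → A))
    (hprev : ∀ k x y, F (k + 1) x = F (k + 1) y → F k x = F k y)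
    (hnext : ∀ k, ∃ b ∈ s, ∀ x y, Z b x = Z b y → F k x = F k y → F (k + 1) x = F (k + 1) y)
    (k : ℕ) :
    ∑ b ∈ s, entropy ν (fun t => (Z b t, F k t)) ≤
      ∑ b ∈ s, entropy ν (Z b) + ((s.card : ℝ) - 1) * entropy ν (F k) := by
  induction k with
  | zero =>
    rw [entropy_eq_zero_of_const ν (F 0) fun x y => Subsingleton.elim _ _, mul_zero, add_zero]
    exact Finset.sum_le_sum fun b _ => entropy_le_of_determines ν _ _
      fun x y h => Prod.ext h (Subsingleton.elim _ _)
  | succ k ih =>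
    obtain ⟨b₀, hb₀, h₀⟩ := hnext k
    -- The speaking block already knows the new symbol, so its term does not grow. Each of the other
    -- `s.card - 1` terms grows by at most `H(F (k + 1)) - H(F k)`.
    have hfix : entropy ν (fun t => (Z b₀ t, F (k + 1) t)) ≤
        entropy ν (fun t => (Z b₀ t, F k t)) :=
      entropy_le_of_determines ν _ _ fun x y h =>
        Prod.ext (Prod.ext_iff.1 h).1 (h₀ x y (Prod.ext_iff.1 h).1 (Prod.ext_iff.1 h).2)
    have hother : ∀ b ∈ s.erase b₀, entropy ν (fun t => (Z b t, F (k + 1) t)) ≤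
        entropy ν (fun t => (Z b t, F k t)) + (entropy ν (F (k + 1)) - entropy ν (F k)) := by
      intro b _
      have := entropy_submodular ν (fun t => (Z b t, F k t)) (F (k + 1))
        (fun t => (Z b t, F (k + 1) t)) (F k) (fun x y h => (Prod.ext_iff.1 h).2)
        (hprev k) (fun x y h1 h2 => Prod.ext (Prod.ext_iff.1 h1).1 h2)
      linarith
    have hsum := Finset.sum_le_sum hother
    rw [Finset.sum_add_distrib, Finset.sum_const, nsmul_eq_mul, Finset.card_erase_of_mem hb₀,
      Nat.cast_sub (Finset.card_pos.2 ⟨b₀, hb₀⟩), Nat.cast_one] at hsum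
    rw [← Finset.add_sum_erase s _ hb₀] at ih ⊢
    linarith

/-- Converse bound for key agreement: a key recoverable from each of the variables `Z b` together
with the discussion `F` has conditional entropy bounded by the multivariate mutual information. -/
lemma card_sub_one_mul_entropy_key_le {A : Type*} [Fintype A] {s : Finset ι}
    (hZ : ∀ x y, (∀ b ∈ s, Z b x = Z b y) → x = y)
    (F : ∀ k : ℕ, T → (Fin k → A))
    (hprev : ∀ k x y, F (k + 1) x = F (k + 1) y → F k x = F k y)
    (hnext : ∀ k, ∃ b ∈ s, ∀ x y, Z b x = Z b y → F k x = F k y → F (k + 1) x = F (k + 1) y)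
    (k : ℕ) {N : ℕ} (K : T → Fin N) {ε : ℝ}
    (hg : ∀ b ∈ s, ∃ g : S b × (Fin k → A) → Fin N, ν.real {t | g (Z b t, F k t) ≠ K t} ≤ ε) :
    ((s.card : ℝ) - 1) * (entropy ν K - mutualInfo ν K (F k)) ≤
      ∑ b ∈ s, entropy ν (Z b) - entropy ν (id : T → T) + s.card * (1 + ε * Real.log N) := by
  have h1 := entropy_family_le_sum ν Z (fun t => (K t, F k t)) s
  have h2 : entropy ν (id : T → T) ≤
      entropy ν (fun t => (fun b : s => Z b t, (K t, F k t))) :=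
    entropy_le_of_determines ν _ _ fun x y h =>
      hZ x y fun b hb => congrFun (Prod.ext_iff.1 h).1 ⟨b, hb⟩
  have h3 := sum_entropy_discussion_le ν Z F hprev hnext k
  have h4 : ∀ b ∈ s, entropy ν (fun t => (Z b t, (K t, F k t))) ≤
      entropy ν (fun t => (Z b t, F k t)) + (1 + ε * Real.log N) := by
    intro b hb
    obtain ⟨g, hgb⟩ := hg b hb
    have f1 := entropy_prod_le_of_estimate ν K (fun t => (Z b t, F k t)) g
    have f2 : entropy ν (fun t => (Z b t, (K t, F k t))) ≤
        entropy ν (fun t => (K t, (Z b t, F k t))) :=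
      entropy_le_of_determines ν _ _ fun x y h => by simp_all
    have f3 := mul_le_mul_of_nonneg_right hgb (Real.log_natCast_nonneg N)
    linarith
  have h5 := Finset.sum_le_sum h4
  rw [Finset.sum_add_distrib, Finset.sum_const, nsmul_eq_mul] at h5
  -- Here `H(K) - I(K; F) = H(K, F) - H(F)`.
  unfold mutualInfo
  linarith

end Discussion

/-! ### The converse for a key agreement scheme -/

namespace Scheme

variable {m : ℕ} {𝒳 : Fin m → Type*} {n : ℕ} (c : Scheme m 𝒳 n)
  {Ω : Type*} [MeasurableSpace Ω] (μ : Measure Ω) [IsProbabilityMeasure μ]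
  {X : ∀ i, Ω → 𝒳 i}

instance : IsProbabilityMeasure (c.law μ) := by
  unfold law
  infer_instance

/-- All the source observations and the private randomness. -/
abbrev Data : Type _ := (∀ i, Fin n → 𝒳 i) × (∀ i, Fin (c.q i))

/-- What the terminals in `B` know before the discussion. -/
def blockData (B : Finset (Fin m)) (t : c.Data) : ∀ i : B, (Fin n → 𝒳 i) × Fin (c.q i) :=
  fun i => (t.1 i, t.2 i)

lemma transcript_prev (k : ℕ) (t t' : c.Data)
    (h : c.transcript t.1 t.2 (k + 1) = c.transcript t'.1 t'.2 (k + 1)) :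
    c.transcript t.1 t.2 k = c.transcript t'.1 t'.2 k := by
  have := congrArg (Fin.init (α := fun _ => Fin c.L)) h
  simpa [transcript] using this

lemma transcript_next (k : ℕ) (t t' : c.Data) (h1 : t.1 (c.speaker k) = t'.1 (c.speaker k))
    (h2 : t.2 (c.speaker k) = t'.2 (c.speaker k))
    (h : c.transcript t.1 t.2 k = c.transcript t'.1 t'.2 k) :
    c.transcript t.1 t.2 (k + 1) = c.transcript t'.1 t'.2 (k + 1) := by
  simp only [transcript, h1, h2, h]

variable [∀ i, MeasurableSpace (𝒳 i)]

lemma measurable_data (hX : ∀ i, Measurable (X i)) :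
    Measurable fun ω : c.Sample Ω => ((c.obs X ω, ω.2) : c.Data) := by
  refine Measurable.prodMk (measurable_pi_lambda _ fun i => measurable_pi_lambda _ fun s => ?_)
    measurable_snd
  exact (hX i).comp ((measurable_pi_apply s).comp measurable_fst)

variable [∀ i, Fintype (𝒳 i)] [∀ i, MeasurableSingletonClass (𝒳 i)]

/-- Entropy of the knowledge of a set of terminals: `n H(X_B) + ∑ H(U_i)`. -/
lemma entropy_blockData (hX : ∀ i, Measurable (X i)) (B : Finset (Fin m)) :
    entropy (c.law μ) (fun ω => c.blockData B (c.obs X ω, ω.2)) =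
      n * entropy μ (fun ω (i : B) => X i ω) +
        ∑ i ∈ B, entropy (c.randLaw i).toMeasure (id : Fin (c.q i) → Fin (c.q i)) := by
  have hXB : Measurable fun ω (i : B) => X i ω := measurable_pi_lambda _ fun i => hX i
  let f : (Fin n → Ω) → (Fin n → ∀ i : B, 𝒳 i) := fun ω s i => X i (ω s)
  let g : (∀ i, Fin (c.q i)) → (∀ i : B, Fin (c.q i)) := fun u i => u i
  have hf : Measurable f := measurable_pi_lambda _ fun s => hXB.comp (measurable_pi_apply s)
  have hg : Measurable g := measurable_pi_lambda _ fun i => measurable_pi_apply _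
  -- Regrouping into a source part and a randomness part exposes the two independent factors of the
  -- law.
  let e : ((∀ i : B, (Fin n → 𝒳 i) × Fin (c.q i))) →
      (Fin n → ∀ i : B, 𝒳 i) × (∀ i : B, Fin (c.q i)) :=
    fun z => (fun s i => (z i).1 s, fun i => (z i).2)
  have he : e.Injective := by
    intro z z' h
    funext i
    refine Prod.ext (funext fun s => ?_) (congrFun (congrArg Prod.snd h) i)
    exact congrFun (congrFun (congrArg Prod.fst h) s) i
  rw [← entropy_comp_injective _ _ e he]
  have hsplit : entropy (c.law μ) (fun ω => (f ω.1, g ω.2)) =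
      entropy (c.law μ) (fun ω => f ω.1) + entropy (c.law μ) (fun ω => g ω.2) :=
    entropy_prodMk_of_indepFun _ (hf.comp measurable_fst) (hg.comp measurable_snd)
      (ProbabilityTheory.indepFun_prod hf hg)
  refine hsplit.trans ?_
  congr 1
  · have h1 : entropy (c.law μ) (fun ω => f ω.1) =
        entropy (Measure.pi fun _ : Fin n => μ) f :=
      entropy_measurePreserving measurePreserving_fst hf
    have h2 := entropy_pi_of_iIndepFun (Measure.pi fun _ : Fin n => μ)
      (f := fun s ω (i : B) => X i (ω s)) (fun s => hXB.comp (measurable_pi_apply s))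
      (ProbabilityTheory.iIndepFun_pi (X := fun _ ω (i : B) => X i ω)
        fun s => hXB.aemeasurable) Finset.univ
    have h3 : ∀ s : Fin n, entropy (Measure.pi fun _ : Fin n => μ) (fun ω (i : B) => X i (ω s)) =
        entropy μ (fun ω (i : B) => X i ω) := fun s =>
      entropy_measurePreserving (measurePreserving_eval (fun _ : Fin n => μ) s) hXB
    rw [h1]
    simp only [h3, Finset.sum_const, Finset.card_univ, Fintype.card_fin, nsmul_eq_mul] at h2
    rw [← h2, ← entropy_comp_injective _ f
      (fun z (s : (Finset.univ : Finset (Fin n))) => z s)]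
    intro z z' h
    funext s
    exact congrFun h ⟨s, Finset.mem_univ s⟩
  · have h1 : entropy (c.law μ) (fun ω => g ω.2) =
        entropy (Measure.pi fun i => (c.randLaw i).toMeasure) g :=
      entropy_measurePreserving measurePreserving_snd hg
    have h2 := entropy_pi_of_iIndepFun (Measure.pi fun i => (c.randLaw i).toMeasure)
      (f := fun i u => u i) (fun i => measurable_pi_apply i)
      (ProbabilityTheory.iIndepFun_pi (X := fun i (u : Fin (c.q i)) => u)
        fun s => aemeasurable_id) B
    rw [h1]
    refine h2.trans (Finset.sum_congr rfl fun i _ => ?_)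
    exact entropy_measurePreserving
      (measurePreserving_eval (fun i => (c.randLaw i).toMeasure) i) measurable_id

/-- The converse for a partition of the terminals. -/
theorem card_parts_sub_one_mul_entropy_key_le (hX : ∀ i, Measurable (X i)) {ε : ℝ}
    (h : c.IsSecretKey X μ Finset.univ ε) (P : Finpartition (Finset.univ : Finset (Fin m))) :
    ((P.parts.card : ℝ) - 1) *
        (entropy (c.law μ) (c.keyRV X) - mutualInfo (c.law μ) (c.keyRV X) (c.publicRV X)) ≤
      n * (∑ B ∈ P.parts, entropy μ (fun ω (i : B) => X i ω) -
        entropy μ (fun ω (i : (Finset.univ : Finset (Fin m))) => X i ω)) +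
        P.parts.card * (1 + ε * Real.log c.keySize) := by
  have hD := c.measurable_data hX
  -- The entropy calculus needs a finite space. `Ω` is arbitrary, but everything in the scheme
  -- factors through the finite type `Data`.
  let ν : Measure c.Data := (c.law μ).map fun ω : c.Sample Ω => (c.obs X ω, ω.2)
  have : IsProbabilityMeasure ν := Measure.isProbabilityMeasure_map hD.aemeasurable
  have hmem : ∀ i, i ∈ P.part i := fun i => P.mem_part (Finset.mem_univ i)
  have hpart : ∀ i, P.part i ∈ P.parts := fun i => P.part_mem.2 (Finset.mem_univ i)
  have main := card_sub_one_mul_entropy_key_le ν (fun B => c.blockData B) (s := P.parts)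
    (ε := ε) ?_ (fun k t => c.transcript t.1 t.2 k) c.transcript_prev ?_ c.slots
    (fun t => c.key t.1 t.2) ?_
  · have hid : entropy ν (id : c.Data → c.Data) = entropy ν (c.blockData Finset.univ) := by
      refine entropy_eq_of_determines ν _ _ fun x y => ⟨fun hxy => ?_, fun hxy => ?_⟩
      · have h' : ∀ i, (x.1 i, x.2 i) = (y.1 i, y.2 i) :=
          fun i => congrFun hxy ⟨i, Finset.mem_univ i⟩
        exact Prod.ext (funext fun i => (Prod.ext_iff.1 (h' i)).1)
          (funext fun i => (Prod.ext_iff.1 (h' i)).2)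
      · rw [show x = y from hxy]
    -- The blocks partition the terminals, so the private randomness contributes equally to `∑
    -- H(Z_B)` and `H(Z)` and cancels.
    have hU : ∑ B ∈ P.parts, ∑ i ∈ B,
          entropy (c.randLaw i).toMeasure (id : Fin (c.q i) → Fin (c.q i)) =
        ∑ i, entropy (c.randLaw i).toMeasure (id : Fin (c.q i) → Fin (c.q i)) := by
      conv_rhs => rw [← P.biUnion_parts]
      exact (Finset.sum_biUnion P.disjoint).symm
    simp only [mutualInfo] at main ⊢
    rw [hid] at main
    simp only [ν, entropy_map _ hD] at main
    simp only [c.entropy_blockData μ hX, Finset.sum_add_distrib, hU, ← Finset.mul_sum] at main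
    exact main.trans (le_of_eq (by ring))
  · intro x y hxy
    have h' : ∀ i, (x.1 i, x.2 i) = (y.1 i, y.2 i) := fun i =>
      congrFun (hxy _ (hpart i)) ⟨i, hmem i⟩
    exact Prod.ext (funext fun i => (Prod.ext_iff.1 (h' i)).1)
      (funext fun i => (Prod.ext_iff.1 (h' i)).2)
  · intro k
    refine ⟨P.part (c.speaker k), hpart _, fun x y hxy hF => ?_⟩
    have h' := Prod.ext_iff.1 (congrFun hxy ⟨c.speaker k, hmem _⟩)
    exact c.transcript_next k x y h'.1 h'.2 hF
  · intro B hB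
    obtain ⟨i, hi⟩ := P.nonempty_of_mem_parts hB
    -- A block can imitate any one of its members.
    refine ⟨fun z => c.estimate i (z.1 ⟨i, hi⟩).1 (z.1 ⟨i, hi⟩).2 z.2, ?_⟩
    have hr := h.recoverable i (Finset.mem_univ i)
    have hms : MeasurableSet {t : c.Data |
        c.estimate i (t.1 i) (t.2 i) (c.transcript t.1 t.2 c.slots) = c.key t.1 t.2} :=
      (Set.toFinite _).measurableSet
    have hc := probReal_compl_eq_one_sub (μ := ν) hms
    have hν : ν.real {t : c.Data |
        c.estimate i (t.1 i) (t.2 i) (c.transcript t.1 t.2 c.slots) = c.key t.1 t.2} =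
        (c.law μ).real {ω | c.estimateRV X i ω = c.keyRV X ω} :=
      map_measureReal_apply hD hms
    have : ν.real {t : c.Data |
        c.estimate i (t.1 i) (t.2 i) (c.transcript t.1 t.2 c.slots) ≠ c.key t.1 t.2} ≤ ε := by
      refine (hc.trans ?_).le.trans (b := 1 - (c.law μ).real _) (by linarith)
      rw [hν]
    exact this

end Scheme

/-! ### Entropies of subfamilies of a finite family of finite-valued variables -/

section Subfamily

variable {κ : Type*} [DecidableEq κ] [Fintype κ] {β : κ → Type*} [∀ p, Fintype (β p)]
  [∀ p, MeasurableSpace (β p)] [∀ p, MeasurableSingletonClass (β p)]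
  (ν : Measure (∀ p, β p)) [IsProbabilityMeasure ν]

/-- The joint entropy of the coordinates in `S`. -/
def coordEntropy (S : Finset κ) : ℝ := entropy ν (fun t (p : S) => t p)

lemma coordEntropy_union_add_inter_le (S R : Finset κ) :
    coordEntropy ν (S ∪ R) + coordEntropy ν (S ∩ R) ≤ coordEntropy ν S + coordEntropy ν R := by
  refine entropy_submodular ν _ _ _ _ (fun x y h => ?_) (fun x y h => ?_) (fun x y h1 h2 => ?_)
  · funext p
    exact congrFun h ⟨p, Finset.inter_subset_left p.2⟩
  · funext p
    exact congrFun h ⟨p, Finset.inter_subset_right p.2⟩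
  · funext p
    rcases Finset.mem_union.1 p.2 with hp | hp
    · exact congrFun h1 ⟨p, hp⟩
    · exact congrFun h2 ⟨p, hp⟩

lemma coordEntropy_empty : coordEntropy ν (∅ : Finset κ) = 0 :=
  entropy_eq_zero_of_const ν _ fun _ _ => funext fun p => absurd p.2 (Finset.notMem_empty _)

lemma coordEntropy_biUnion_le {γ : Type*} [DecidableEq γ] (E : Finset γ) (R : γ → Finset κ) :
    coordEntropy ν (E.biUnion R) ≤ ∑ e ∈ E, coordEntropy ν (R e) := by
  induction E using Finset.induction_on with
  | empty => simp [coordEntropy_empty]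
  | insert a E ha ih =>
    rw [Finset.sum_insert ha, Finset.biUnion_insert]
    have h1 := coordEntropy_union_add_inter_le ν (R a) (E.biUnion R)
    have h2 : 0 ≤ coordEntropy ν (R a ∩ E.biUnion R) := entropy_nonneg ν _
    linarith

/-- If each of the disjoint blocks `R e` is independent of all the other coordinates, then the
blocks are mutually independent. -/
lemma sum_coordEntropy_le_biUnion {γ : Type*} [DecidableEq γ] (E : Finset γ) (R : γ → Finset κ)
    (hdisj : (E : Set γ).PairwiseDisjoint R)
    (hind : ∀ e ∈ E, coordEntropy ν (R e) + coordEntropy ν (R e)ᶜ =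
      coordEntropy ν Finset.univ) :
    ∑ e ∈ E, coordEntropy ν (R e) ≤ coordEntropy ν (E.biUnion R) := by
  induction E using Finset.induction_on with
  | empty => simp [coordEntropy_empty]
  | insert a E ha ih =>
    have ih' := ih (hdisj.subset (by simp)) fun e he => hind e (Finset.mem_insert_of_mem he)
    rw [Finset.sum_insert ha, Finset.biUnion_insert]
    have hd : Disjoint (R a) (E.biUnion R) := by
      rw [Finset.disjoint_biUnion_right]
      intro e he
      exact hdisj (by simp) (by simp [he]) (by rintro rfl; exact ha he)
    -- These two sets have union everything and, by disjointness, intersection `E.biUnion R`. The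
    -- independence of `R a` from its complement then removes the two large terms.
    have h1 := coordEntropy_union_add_inter_le ν (R a ∪ E.biUnion R) (R a)ᶜ
    have e1 : R a ∪ E.biUnion R ∪ (R a)ᶜ = Finset.univ := by
      ext p
      simp only [Finset.mem_union, Finset.mem_compl, Finset.mem_univ, iff_true]
      tauto
    have e2 : (R a ∪ E.biUnion R) ∩ (R a)ᶜ = E.biUnion R := by
      ext p
      have : p ∈ R a → p ∉ E.biUnion R := fun hp => Finset.disjoint_left.1 hd hp
      rw [Finset.mem_inter, Finset.mem_union, Finset.mem_compl]
      tauto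
    rw [e1, e2] at h1
    have h2 := hind a (Finset.mem_insert_self _ _)
    linarith

end Subfamily

/-! ### The multivariate mutual information of a pair-wise independent network -/

section PIN

variable {m : ℕ}

/-- The ordered pairs of distinct terminals. -/
abbrev OffDiag (m : ℕ) : Type := {p : Fin m × Fin m // p.1 ≠ p.2}

/-- The edges of the complete graph, each listed once. -/
def edges (m : ℕ) : Finset (Fin m × Fin m) := {e : Fin m × Fin m | e.1 < e.2}

/-- The two orientations of the edge `e`. -/
def orientations (e : Fin m × Fin m) : Finset (OffDiag m) :=
  {p : OffDiag m | p.1 = e ∨ p.1 = e.swap}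

/-- The pairs whose first component lies in `B`. -/
def pairsFrom (B : Finset (Fin m)) : Finset (OffDiag m) := {p : OffDiag m | p.1.1 ∈ B}

lemma pairwiseDisjoint_orientations :
    (edges m : Set (Fin m × Fin m)).PairwiseDisjoint orientations := by
  rintro ⟨i, j⟩ he ⟨k, l⟩ hf hne
  simp only [edges, Finset.coe_filter, Finset.mem_univ, true_and, Set.mem_ofPred_eq] at he hf
  rw [Function.onFun, Finset.disjoint_left]
  rintro ⟨⟨a, b⟩, hab⟩ h1 h2
  simp only [orientations, Finset.mem_filter, Finset.mem_univ, true_and, Prod.mk.injEq,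
    Prod.swap_prod_mk] at h1 h2
  simp only [ne_eq, Prod.mk.injEq] at hne
  omega

lemma biUnion_orientations : (edges m).biUnion orientations = Finset.univ := by
  ext ⟨⟨i, j⟩, hij⟩
  simp only [edges, orientations, Finset.mem_biUnion, Finset.mem_filter, Finset.mem_univ, true_and,
    iff_true]
  rcases lt_or_gt_of_ne hij with h | h
  · exact ⟨(i, j), h, Or.inl rfl⟩
  · exact ⟨(j, i), h, Or.inr rfl⟩

variable {α : Fin m → Fin m → Type*} {Ω : Type*} [MeasurableSpace Ω]
  [∀ i j, MeasurableSpace (α i j)]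

/-- The joint law of the variables `Y i j`, `i ≠ j`. -/
def pairLaw (μ : Measure Ω) (Y : ∀ i j, Ω → α i j) :
    Measure (∀ p : OffDiag m, α p.1.1 p.1.2) :=
  μ.map fun ω p => Y p.1.1 p.1.2 ω

lemma measurable_pairs {Y : ∀ i j, Ω → α i j} (hY : ∀ i j, i ≠ j → Measurable (Y i j)) :
    Measurable fun ω (p : OffDiag m) => Y p.1.1 p.1.2 ω :=
  measurable_pi_lambda _ fun p => hY _ _ p.2

lemma isProbabilityMeasure_pairLaw (μ : Measure Ω) [IsProbabilityMeasure μ] {Y : ∀ i j, Ω → α i j}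
    (hY : ∀ i j, i ≠ j → Measurable (Y i j)) : IsProbabilityMeasure (pairLaw μ Y) :=
  Measure.isProbabilityMeasure_map (measurable_pairs hY).aemeasurable

variable [∀ i j, Fintype (α i j)] [∀ i j, MeasurableSingletonClass (α i j)]

lemma entropy_pairLaw (μ : Measure Ω) {Y : ∀ i j, Ω → α i j}
    (hY : ∀ i j, i ≠ j → Measurable (Y i j)) {S : Type*} [Fintype S]
    (f : (∀ p : OffDiag m, α p.1.1 p.1.2) → S) :
    entropy (pairLaw μ Y) f = entropy μ (fun ω => f fun p => Y p.1.1 p.1.2 ω) :=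
  entropy_map μ (measurable_pairs hY) f

variable (μ : Measure Ω) [IsProbabilityMeasure μ] {Y : ∀ i j, Ω → α i j}
  (hY : ∀ i j, i ≠ j → Measurable (Y i j))

include hY

/-- Passing to off-diagonal coordinates turns questions about blocks into set operations on index
pairs. -/
lemma entropy_observation (B : Finset (Fin m)) :
    entropy μ (fun ω (i : B) => observation Y i ω) = coordEntropy (pairLaw μ Y) (pairsFrom B) := by
  have := isProbabilityMeasure_pairLaw μ hY
  have h1 := entropy_pairLaw μ hY (fun t (i : B) (j : {j : Fin m // j ≠ i}) =>
    t ⟨(i, j), j.2.symm⟩)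
  refine h1.symm.trans (entropy_eq_of_determines _ _ _ fun x y => ⟨fun h => ?_, fun h => ?_⟩)
  · funext i j
    exact congrFun h ⟨⟨(i, j), j.2.symm⟩, by simp [pairsFrom]⟩
  · funext ⟨⟨⟨i, j⟩, hij⟩, hp⟩
    have hi : i ∈ B := by simpa [pairsFrom] using hp
    exact congrFun (congrFun h ⟨i, hi⟩) ⟨j, hij.symm⟩

lemma coordEntropy_singleton {i j : Fin m} (hij : i ≠ j) :
    coordEntropy (pairLaw μ Y) {⟨(i, j), hij⟩} = entropy μ (Y i j) := by
  have := isProbabilityMeasure_pairLaw μ hY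
  have h1 := entropy_pairLaw μ hY (fun t => t ⟨(i, j), hij⟩)
  refine Eq.trans (entropy_eq_of_determines _ _ _ fun x y => ⟨fun h => ?_, fun h => ?_⟩) h1
  · funext ⟨p, hp⟩
    obtain rfl := Finset.mem_singleton.1 hp
    exact h
  · exact congrFun h ⟨_, Finset.mem_singleton_self _⟩

lemma coordEntropy_orientations {i j : Fin m} (hij : i ≠ j) :
    coordEntropy (pairLaw μ Y) (orientations (i, j)) =
      entropy μ (fun ω => (Y i j ω, Y j i ω)) := by
  have := isProbabilityMeasure_pairLaw μ hY
  have h1 := entropy_pairLaw μ hY (fun t => (t ⟨(i, j), hij⟩, t ⟨(j, i), hij.symm⟩))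
  refine Eq.trans (entropy_eq_of_determines _ _ _ fun x y => ⟨fun h => ?_, fun h => ?_⟩) h1
  · rw [Prod.ext_iff] at h
    funext ⟨⟨p, hp⟩, hp'⟩
    simp only [orientations, Finset.mem_filter, Finset.mem_univ, true_and, Prod.swap_prod_mk] at hp'
    rcases hp' with rfl | rfl
    · exact h.1
    · exact h.2
  · exact Prod.ext (congrFun h ⟨⟨(i, j), hij⟩, by simp [orientations]⟩)
      (congrFun h ⟨⟨(j, i), hij.symm⟩, by simp [orientations]⟩)

/-- This puts the independence hypothesis into the form required by `sum_coordEntropy_le_biUnion`.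
-/
lemma coordEntropy_orientations_add_compl (hind : PairwiseIndependent μ Y) {i j : Fin m}
    (hij : i ≠ j) :
    coordEntropy (pairLaw μ Y) (orientations (i, j)) +
      coordEntropy (pairLaw μ Y) (orientations (i, j))ᶜ =
      coordEntropy (pairLaw μ Y) Finset.univ := by
  have := isProbabilityMeasure_pairLaw μ hY
  have hmem : ∀ p : {p : Fin m × Fin m // p.1 ≠ p.2 ∧ p ≠ (i, j) ∧ p ≠ (j, i)},
      (⟨p.1, p.2.1⟩ : OffDiag m) ∈ (orientations (i, j))ᶜ := fun p => by
    simp [orientations, p.2.2.1, p.2.2.2]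
  have h0 := hind i j hij
  rw [mutualInfo, ← coordEntropy_orientations μ hY hij] at h0
  have h1 := entropy_pairLaw μ hY
    (fun t (p : {p : Fin m × Fin m // p.1 ≠ p.2 ∧ p ≠ (i, j) ∧ p ≠ (j, i)}) => t ⟨p.1, p.2.1⟩)
  have h2 := entropy_pairLaw μ hY (fun t => ((t ⟨(i, j), hij⟩, t ⟨(j, i), hij.symm⟩),
    fun (p : {p : Fin m × Fin m // p.1 ≠ p.2 ∧ p ≠ (i, j) ∧ p ≠ (j, i)}) => t ⟨p.1, p.2.1⟩))
  rw [← h1, ← h2] at h0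
  have h3 : coordEntropy (pairLaw μ Y) (orientations (i, j))ᶜ = entropy (pairLaw μ Y)
      (fun t (p : {p : Fin m × Fin m // p.1 ≠ p.2 ∧ p ≠ (i, j) ∧ p ≠ (j, i)}) =>
        t ⟨p.1, p.2.1⟩) := by
    refine entropy_eq_of_determines _ _ _ fun x y => ⟨fun h => ?_, fun h => ?_⟩
    · funext ⟨⟨p, hp⟩, hp'⟩
      simp only [orientations, Finset.mem_compl, Finset.mem_filter, Finset.mem_univ, true_and,
        not_or, Prod.swap_prod_mk] at hp'
      exact congrFun h ⟨p, hp, hp'⟩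
    · funext p
      exact congrFun h ⟨_, hmem p⟩
  have h4 : coordEntropy (pairLaw μ Y) Finset.univ = entropy (pairLaw μ Y)
      (fun t => ((t ⟨(i, j), hij⟩, t ⟨(j, i), hij.symm⟩),
        fun (p : {p : Fin m × Fin m // p.1 ≠ p.2 ∧ p ≠ (i, j) ∧ p ≠ (j, i)}) =>
          t ⟨p.1, p.2.1⟩)) := by
    refine entropy_eq_of_determines _ _ _ fun x y => ⟨fun h => ?_, fun h => ?_⟩
    · obtain ⟨ha, hb⟩ := Prod.ext_iff.1 h
      obtain ⟨ha, hc⟩ := Prod.ext_iff.1 ha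
      funext ⟨⟨p, hp⟩, _⟩
      by_cases h1 : p = (i, j)
      · subst h1
        exact ha
      by_cases h2 : p = (j, i)
      · subst h2
        exact hc
      exact congrFun hb ⟨p, hp, h1, h2⟩
    · have h' : ∀ p, x p = y p := fun p => congrFun h ⟨p, Finset.mem_univ p⟩
      simp only [h']
  rw [h3, h4]
  linarith

/-- If the edge is not cut, a single block sees both variables and the others see neither. If it is
cut, two blocks see one variable each, and `H(Y_{i,j}) + H(Y_{j,i})` exceeds the joint entropy by
the edge weight. -/
lemma sum_parts_coordEntropy_inter (P : Finpartition (Finset.univ : Finset (Fin m)))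
    {e : Fin m × Fin m} (he : e.1 ≠ e.2) :
    ∑ B ∈ P.parts, coordEntropy (pairLaw μ Y) (pairsFrom B ∩ orientations e) =
      coordEntropy (pairLaw μ Y) (orientations e) +
        if P.part e.1 ≠ P.part e.2 then edgeWeight μ Y e.1 e.2 else 0 := by
  have := isProbabilityMeasure_pairLaw μ hY
  obtain ⟨i, j⟩ := e
  simp only at he ⊢
  have hmem : ∀ B ∈ P.parts, ∀ i, i ∈ B ↔ B = P.part i := fun B hB i =>
    ⟨fun h => (P.part_eq_of_mem hB h).symm, fun h => h ▸ P.mem_part (Finset.mem_univ i)⟩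
  have hpart : ∀ i, P.part i ∈ P.parts := fun i => P.part_mem.2 (Finset.mem_univ i)
  by_cases hc : P.part i = P.part j
  · have hterm : ∀ B ∈ P.parts,
        coordEntropy (pairLaw μ Y) (pairsFrom B ∩ orientations (i, j)) =
        if B = P.part i then coordEntropy (pairLaw μ Y) (orientations (i, j)) else 0 := by
      intro B hB
      split_ifs with hBi
      · congr 1
        rw [Finset.inter_eq_right]
        rintro ⟨p, hp⟩ hp'
        simp only [orientations, Finset.mem_filter, Finset.mem_univ, true_and,
          Prod.swap_prod_mk] at hp'
        simp only [pairsFrom, Finset.mem_filter, Finset.mem_univ, true_and]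
        rcases hp' with rfl | rfl
        · exact (hmem B hB i).2 hBi
        · exact (hmem B hB j).2 (hBi.trans hc)
      · rw [← coordEntropy_empty (pairLaw μ Y)]
        congr 1
        rw [Finset.eq_empty_iff_forall_notMem]
        rintro ⟨p, hp⟩ hp'
        simp only [pairsFrom, orientations, Finset.mem_inter, Finset.mem_filter, Finset.mem_univ,
          true_and, Prod.swap_prod_mk] at hp'
        obtain ⟨hpB, rfl | rfl⟩ := hp'
        · exact hBi ((hmem B hB i).1 hpB)
        · exact hBi (((hmem B hB j).1 hpB).trans hc.symm)
    rw [Finset.sum_congr rfl hterm, Finset.sum_ite_eq' , if_pos (hpart i)]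
    simp [hc]
  · have hterm : ∀ B ∈ P.parts,
        coordEntropy (pairLaw μ Y) (pairsFrom B ∩ orientations (i, j)) =
        (if B = P.part i then entropy μ (Y i j) else 0) +
          (if B = P.part j then entropy μ (Y j i) else 0) := by
      intro B hB
      by_cases hBi : B = P.part i
      · have hBj : B ≠ P.part j := fun h => hc (hBi.symm.trans h)
        rw [if_pos hBi, if_neg hBj, add_zero, ← coordEntropy_singleton μ hY he]
        congr 1
        ext ⟨p, hp⟩
        simp only [pairsFrom, orientations, Finset.mem_inter, Finset.mem_filter, Finset.mem_univ,
          true_and, Prod.swap_prod_mk, Finset.mem_singleton, Subtype.mk.injEq]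
        constructor
        · rintro ⟨hpB, rfl | rfl⟩
          · rfl
          · exact absurd ((hmem B hB j).1 hpB) hBj
        · rintro rfl
          exact ⟨(hmem B hB i).2 hBi, Or.inl rfl⟩
      by_cases hBj : B = P.part j
      · rw [if_pos hBj, if_neg hBi, zero_add, ← coordEntropy_singleton μ hY he.symm]
        congr 1
        ext ⟨p, hp⟩
        simp only [pairsFrom, orientations, Finset.mem_inter, Finset.mem_filter, Finset.mem_univ,
          true_and, Prod.swap_prod_mk, Finset.mem_singleton, Subtype.mk.injEq]
        constructor
        · rintro ⟨hpB, rfl | rfl⟩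
          · exact absurd ((hmem B hB i).1 hpB) hBi
          · rfl
        · rintro rfl
          exact ⟨(hmem B hB j).2 hBj, Or.inr rfl⟩
      · rw [if_neg hBi, if_neg hBj, add_zero, ← coordEntropy_empty (pairLaw μ Y)]
        congr 1
        rw [Finset.eq_empty_iff_forall_notMem]
        rintro ⟨p, hp⟩ hp'
        simp only [pairsFrom, orientations, Finset.mem_inter, Finset.mem_filter, Finset.mem_univ,
          true_and, Prod.swap_prod_mk] at hp'
        obtain ⟨hpB, rfl | rfl⟩ := hp'
        · exact hBi ((hmem B hB i).1 hpB)
        · exact hBj ((hmem B hB j).1 hpB)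
    rw [Finset.sum_congr rfl hterm, Finset.sum_add_distrib, Finset.sum_ite_eq',
      Finset.sum_ite_eq', if_pos (hpart i), if_pos (hpart j), if_pos hc,
      coordEntropy_orientations μ hY he, edgeWeight, mutualInfo]
    ring

/-- In a pair-wise independent network the multivariate mutual information of the blocks of a
partition is at most the weight of the corresponding multi-cut. -/
theorem sum_entropy_observation_sub_le (hind : PairwiseIndependent μ Y)
    (P : Finpartition (Finset.univ : Finset (Fin m))) :
    ∑ B ∈ P.parts, entropy μ (fun ω (i : B) => observation Y i ω) -
        entropy μ (fun ω (i : (Finset.univ : Finset (Fin m))) => observation Y i ω) ≤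
      multiCutWeight (edgeWeight μ Y) P := by
  have := isProbabilityMeasure_pairLaw μ hY
  have hne : ∀ e ∈ edges m, e.1 ≠ e.2 := fun e he => by
    simp only [edges, Finset.mem_filter, Finset.mem_univ, true_and] at he
    exact he.ne
  simp only [entropy_observation μ hY]
  -- The block entropies need only subadditivity over edges; independence is used only to bound the
  -- total entropy from below in `hlow`.
  have hup : ∀ B ∈ P.parts, coordEntropy (pairLaw μ Y) (pairsFrom B) ≤
      ∑ e ∈ edges m, coordEntropy (pairLaw μ Y) (pairsFrom B ∩ orientations e) := by
    intro B _
    have h := coordEntropy_biUnion_le (pairLaw μ Y) (edges m)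
      (fun e => pairsFrom B ∩ orientations e)
    rwa [← Finset.inter_biUnion, biUnion_orientations, Finset.inter_univ] at h
  have hlow := sum_coordEntropy_le_biUnion (pairLaw μ Y) (edges m) orientations
    pairwiseDisjoint_orientations
    fun e he => coordEntropy_orientations_add_compl μ hY hind (hne e he)
  rw [biUnion_orientations] at hlow
  have huniv : pairsFrom (Finset.univ : Finset (Fin m)) = Finset.univ := by simp [pairsFrom]
  have hsum := Finset.sum_le_sum hup
  rw [Finset.sum_comm, Finset.sum_congr rfl fun e he =>
    sum_parts_coordEntropy_inter μ hY P (hne e he), Finset.sum_add_distrib,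
    ← Finset.sum_filter, edges, Finset.filter_filter] at hsum
  rw [edges] at hlow
  rw [huniv, multiCutWeight]
  linarith

end PIN

/-! ### The upper bound on achievable rates -/

section Rates

variable {m : ℕ} {𝒳 : Fin m → Type*} [∀ i, Fintype (𝒳 i)] [∀ i, MeasurableSpace (𝒳 i)]
  [∀ i, MeasurableSingletonClass (𝒳 i)] {Ω : Type*} [MeasurableSpace Ω]
  (μ : Measure Ω) [IsProbabilityMeasure μ] {X : ∀ i, Ω → 𝒳 i}

/-- An achievable rate is bounded by the normalized multivariate mutual information of every
partition of the terminals. -/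
theorem IsAchievableRate.mul_le (hX : ∀ i, Measurable (X i)) {R : ℝ}
    (hR : IsAchievableRate μ X Finset.univ R) (P : Finpartition (Finset.univ : Finset (Fin m)))
    (hP : 2 ≤ P.parts.card) :
    ((P.parts.card : ℝ) - 1) * R ≤ ∑ B ∈ P.parts, entropy μ (fun ω (i : B) => X i ω) -
        entropy μ (fun ω (i : (Finset.univ : Finset (Fin m))) => X i ω) := by
  set W := ∑ B ∈ P.parts, entropy μ (fun ω (i : B) => X i ω) -
    entropy μ (fun ω (i : (Finset.univ : Finset (Fin m))) => X i ω) with hW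
  set l : ℝ := (P.parts.card : ℝ) with hl
  have hl2 : 2 ≤ l := by rw [hl]; exact_mod_cast hP
  -- Since `l ≥ 2`, the condition `ε < 1 / 4` keeps the coefficient `l - 1 - l * ε` nonnegative, so
  -- that `R - ε ≤ H(K) / n` may be multiplied by it.
  have key : ∀ ε : ℝ, 0 < ε → ε < 1 / 4 →
      (l - 1 - l * ε) * (R - ε) - (l - 1) * ε - l * ε * ε - l * ε ≤ W := by
    intro ε hε hε4
    -- Taking `n ≥ 1 / ε` makes the constant `1` of Fano's inequality at most `n * ε`.
    obtain ⟨n, ⟨c, hc, hRc⟩, hn, hnε⟩ := ((hR ε hε).and ((eventually_gt_atTop 0).and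
      (tendsto_natCast_atTop_atTop.eventually_ge_atTop (1 / ε)))).exists
    have hn' : (0 : ℝ) < n := by exact_mod_cast hn
    have main := c.card_parts_sub_one_mul_entropy_key_le μ hX hc P
    rw [← hW, ← hl] at main
    have hsec := hc.secret
    have huni := hc.uniform
    set H := entropy (c.law μ) (c.keyRV X)
    set I := mutualInfo (c.law μ) (c.keyRV X) (c.publicRV X)
    set N := Real.log c.keySize
    have hH : H = n * (H / n) := by field_simp
    have hI : I ≤ n * ε := by rwa [div_le_iff₀ hn', mul_comm] at hsec
    -- Near-uniformity controls the alphabet size in the Fano term by the key entropy itself, whence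
    -- the coefficient `l - 1 - l * ε`.
    have hN : N ≤ n * (H / n + ε) := by
      have : N / n ≤ H / n + ε := by linarith
      rwa [div_le_iff₀ hn', mul_comm] at this
    have h1n : 1 ≤ n * ε := by rwa [div_le_iff₀ hε] at hnε
    obtain ⟨h, hh⟩ : ∃ h, h = H / n := ⟨_, rfl⟩
    rw [← hh] at hH hN hRc
    have step : n * ((l - 1) * (h - ε)) ≤ n * (W + l * (ε + ε * (h + ε))) := by
      have a1 : (l - 1) * (n * h - n * ε) ≤ (l - 1) * (H - I) :=
        mul_le_mul_of_nonneg_left (by linarith) (by linarith)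
      have a2 : l * (1 + ε * N) ≤ l * (n * ε + ε * (n * (h + ε))) :=
        mul_le_mul_of_nonneg_left (add_le_add h1n (mul_le_mul_of_nonneg_left hN hε.le)) (by linarith)
      linarith
    have step' := le_of_mul_le_mul_left step hn'
    have hpos : 0 ≤ l - 1 - l * ε := by nlinarith
    have := mul_le_mul_of_nonneg_left hRc hpos
    linarith
  have hlim : Tendsto (fun ε : ℝ =>
      (l - 1 - l * ε) * (R - ε) - (l - 1) * ε - l * ε * ε - l * ε) (nhdsWithin 0 (Set.Ioi 0))
      (nhds ((l - 1) * R)) := by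
    have hcont : Continuous fun ε : ℝ =>
      (l - 1 - l * ε) * (R - ε) - (l - 1) * ε - l * ε * ε - l * ε := by fun_prop
    have := (hcont.tendsto 0).mono_left (nhdsWithin_le_nhds (s := Set.Ioi 0))
    simpa using this
  refine le_of_tendsto hlim ?_
  filter_upwards [Ioo_mem_nhdsGT (show (0 : ℝ) < 1 / 4 by norm_num)] with ε hε
  exact key ε hε.1 hε.2

end Rates

/-! ### Comparison of multi-cuts and the capacity bound -/

section Bounds

variable {m : ℕ}

lemma minNormalizedWeight_le_minCutWeight (w : Fin m → Fin m → ℝ) :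
    minNormalizedWeight w ≤ minCutWeight w := by
  refine le_iInf₂ fun P hP => (iInf₂_le P hP.ge).trans ?_
  rw [normalizedWeight, hP]
  norm_num

lemma minNormalizedWeight_le_totalWeight (hm : 2 ≤ m) (w : Fin m → Fin m → ℝ) :
    minNormalizedWeight w ≤ ((totalWeight w / ((m : ℝ) - 1) : ℝ) : EReal) := by
  -- The partition `⊥` into singletons cuts every edge.
  have hcard : (⊥ : Finpartition (Finset.univ : Finset (Fin m))).parts.card = m := by
    rw [Finpartition.card_bot, Finset.card_univ, Fintype.card_fin]
  refine (iInf₂_le (⊥ : Finpartition (Finset.univ : Finset (Fin m))) (by rw [hcard]; exact hm)).trans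
    (le_of_eq ?_)
  rw [normalizedWeight, hcard, multiCutWeight, totalWeight]
  congr 3
  ext e
  simp only [Finset.mem_filter, Finset.mem_univ, true_and, and_iff_left_iff_imp]
  intro he h
  have hpart : ∀ i : Fin m, (⊥ : Finpartition (Finset.univ : Finset (Fin m))).part i = {i} :=
    fun i => Finpartition.part_eq_of_mem _
      (Finpartition.mem_bot_iff.2 ⟨i, Finset.mem_univ i, rfl⟩) (Finset.mem_singleton_self i)
  rw [hpart, hpart, Finset.singleton_inj] at h
  exact he.ne h

/-- The secret key capacity of a pair-wise independent network is at most the minimal normalized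
weight of the multi-cuts. -/
theorem secretKeyCapacity_le_minNormalizedWeight {Ω : Type*} [MeasurableSpace Ω]
    (μ : Measure Ω) [IsProbabilityMeasure μ] {α : Fin m → Fin m → Type*}
    [∀ i j, Fintype (α i j)] [∀ i j, MeasurableSpace (α i j)]
    [∀ i j, MeasurableSingletonClass (α i j)] {Y : ∀ i j, Ω → α i j}
    (hY : ∀ i j, i ≠ j → Measurable (Y i j)) (hind : PairwiseIndependent μ Y) :
    secretKeyCapacity μ (observation Y) Finset.univ ≤ minNormalizedWeight (edgeWeight μ Y) := by
  refine iSup₂_le fun R hR => le_iInf₂ fun P hP => EReal.coe_le_coe_iff.2 ?_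
  have hX : ∀ i, Measurable (observation Y i) := fun i =>
    measurable_pi_lambda _ fun j => hY i j j.2.symm
  have h := (hR.mul_le μ hX P hP).trans (sum_entropy_observation_sub_le μ hY hind P)
  have hl : (2 : ℝ) ≤ P.parts.card := by exact_mod_cast hP
  rw [normalizedWeight, le_div_iff₀ (by linarith)]
  linarith

end Bounds

end GroupKey

end

open GroupKey in
theorem corollary1 {m : ℕ} (hm : 2 ≤ m) {Ω : Type*} [MeasurableSpace Ω]
    (μ : MeasureTheory.Measure Ω) [MeasureTheory.IsProbabilityMeasure μ]
    {α : Fin m → Fin m → Type*} [∀ i j, Fintype (α i j)] [∀ i j, MeasurableSpace (α i j)]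
    [∀ i j, MeasurableSingletonClass (α i j)]
    (Y : ∀ i j, Ω → α i j) (hY : ∀ i j, i ≠ j → Measurable (Y i j))
    (hind : PairwiseIndependent μ Y) :
    secretKeyCapacity μ (observation Y) Finset.univ ≤ minNormalizedWeight (edgeWeight μ Y) ∧
    (minNormalizedWeight (edgeWeight μ Y) ≤ minCutWeight (edgeWeight μ Y) ∧
      secretKeyCapacity μ (observation Y) Finset.univ ≤ minCutWeight (edgeWeight μ Y)) ∧
    (minNormalizedWeight (edgeWeight μ Y) ≤
        ((totalWeight (edgeWeight μ Y) / ((m : ℝ) - 1) : ℝ) : EReal) ∧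
      secretKeyCapacity μ (observation Y) Finset.univ ≤
        ((totalWeight (edgeWeight μ Y) / ((m : ℝ) - 1) : ℝ) : EReal)) := by
  have h := secretKeyCapacity_le_minNormalizedWeight μ hY hind
  have h1 := minNormalizedWeight_le_minCutWeight (edgeWeight μ Y)
  have h2 := minNormalizedWeight_le_totalWeight hm (edgeWeight μ Y)
  exact ⟨h, ⟨h1, h.trans h1⟩, ⟨h2, h.trans h2⟩⟩
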